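/- Let $\mathbb{K}\in\{\mathbb{R},\mathbb{C}\}$ and let $E$ be a semi-Montel space, i.e. a locally convex Hausdorff space over $\mathbb{K}$ in which every bounded set is relatively compact. Let $E'$ be the space of continuous linear functionals on $E$ and let $G\subset E'$ be a linear subspace that determines boundedness, i.e. every $\sigma(E,G)$-bounded subset of $E$ is bounded in $E$, where $\sigma(E,G)$ is the coarsest topology on $E$ that makes all $e'\in G$ continuous. Let $d,k\geq 0$ be integers and let $\Omega\subset\mathbb{R}^d$ be open. For a locally convex Hausdorff space $F$, write $f\in\mathcal{C}^0(\Omega,F)$ if $f\colon\Omega\to F$ is continuous and, recursively, for $k\geq 1$, write $f\in\mathcal{C}^k(\Omega,F)$ if for every $1\leq n\leq d$ the limit $$\partial^{e_n}f(x):=\lim_{h\to 0,\,h\in\mathbb{R}\setminus\{0\}}\frac{f(x+he_n)-f(x)}{h}$$ exists in $F$ for every $x\in\Omega$, and $\partial^{e_n}f$ is continuous on $\Omega$ and belongs to $\mathcal{C}^{k-1}(\Omega,F)$. Write $\mathcal{C}^k(\Omega):=\mathcal{C}^k(\Omega,\mathbb{K})$. If $f\colon\Omega\to E$ is such that $e'\circ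 f\in\mathcal{C}^k(\Omega)$ for all $e'\in G$, then $f\in\mathcal{C}^k(\Omega,E)$. -/

import Mathlib

open Filter Topology Bornology

/-- The weak topology `σ(E, G)`: the coarsest topology on `E` that makes all functionals in the
linear subspace `G` of the topological dual `E'` continuous. -/
abbrev sigmaTopology {𝕜 E : Type*} [RCLike 𝕜] [AddCommGroup E] [Module 𝕜 E]
    [TopologicalSpace E] (G : Submodule 𝕜 (E →L[𝕜] 𝕜)) : TopologicalSpace E :=
  ⨅ e' : G, TopologicalSpace.induced (fun x : E => e'.1 x) inferInstance

/-- A linear subspace `G` of the topological dual `E'` determines boundedness if every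
`σ(E, G)`-bounded subset of `E` is bounded in `E`. -/
def DeterminesBoundedness {𝕜 E : Type*} [RCLike 𝕜] [AddCommGroup E] [Module 𝕜 E]
    [TopologicalSpace E] (G : Submodule 𝕜 (E →L[𝕜] 𝕜)) : Prop :=
  ∀ B : Set E, @IsVonNBounded 𝕜 E _ _ _ (sigmaTopology G) B → IsVonNBounded 𝕜 B

/-- Boundedness for `σ(E, G)` is pointwise boundedness on `G`. -/
theorem isVonNBounded_sigmaTopology_iff {𝕜 E : Type*} [RCLike 𝕜] [AddCommGroup E] [Module 𝕜 E]
    [TopologicalSpace E] (G : Submodule 𝕜 (E →L[𝕜] 𝕜)) (B : Set E) :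
    @IsVonNBounded 𝕜 E _ _ _ (sigmaTopology G) B ↔
      ∀ e' ∈ G, ∃ C : ℝ, ∀ x ∈ B, ‖e' x‖ ≤ C := by
  constructor
  · intro h e' he
    have h1 : IsVonNBounded 𝕜 (e' '' B) := by
      have hc : @Continuous E 𝕜 (sigmaTopology G) _ (fun x => e' x) :=
        continuous_iInf_dom (i := (⟨e', he⟩ : G)) continuous_induced_dom
      exact @IsVonNBounded.image E 𝕜 𝕜 𝕜 _ _ _ _ _ _ (sigmaTopology G) _ (RingHom.id 𝕜) _ _ B h
        (@ContinuousLinearMap.mk 𝕜 𝕜 _ _ (RingHom.id 𝕜) E (sigmaTopology G) _ 𝕜 _ _ _ _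
          e'.toLinearMap hc)
    rw [NormedSpace.isVonNBounded_iff, isBounded_iff_forall_norm_le] at h1
    obtain ⟨C, hC⟩ := h1
    exact ⟨C, fun x hx => hC _ ⟨x, hx, rfl⟩⟩
  · intro h V hV
    rw [nhds_iInf, Filter.mem_iInf] at hV
    obtain ⟨I, hI, W, hW, rfl⟩ := hV
    have := hI.to_subtype
    refine absorbs_iInter.2 fun i => ?_
    have hWi := hW i
    rw [nhds_induced] at hWi
    obtain ⟨U, hU, hUW⟩ := hWi
    rw [map_zero] at hU
    obtain ⟨C, hC⟩ := h i.1.1 i.1.2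
    have hb : IsVonNBounded 𝕜 ((fun x => i.1.1 x) '' B) := by
      rw [NormedSpace.isVonNBounded_iff, isBounded_iff_forall_norm_le]
      exact ⟨C, by rintro _ ⟨x, hx, rfl⟩; exact hC x hx⟩
    filter_upwards [hb hU, eventually_ne_cobounded (0 : 𝕜)] with a ha ha0 x hx
    obtain ⟨u, hu, hux⟩ := ha ⟨x, hx, rfl⟩
    refine ⟨a⁻¹ • x, hUW ?_, smul_inv_smul₀ ha0 x⟩
    have hxu : i.1.1 (a⁻¹ • x) = u := by
      rw [map_smul, inv_smul_eq_iff₀ ha0]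
      exact hux.symm
    change i.1.1 (a⁻¹ • x) ∈ U
    rwa [hxu]

/-- `g` is the partial derivative of `f` in the direction of the `n`-th unit vector on `Ω`:
at every `x ∈ Ω` the difference quotients `h⁻¹ (f (x + h eₙ) - f x)`, `h` real and nonzero,
converge to `g x` as `h → 0`. -/
def HasPartialDerivOn {d : ℕ} {E : Type*} [AddCommGroup E] [Module ℝ E] [TopologicalSpace E]
    (n : Fin d) (f g : EuclideanSpace ℝ (Fin d) → E) (Ω : Set (EuclideanSpace ℝ (Fin d))) : Prop :=
  ∀ x ∈ Ω, Tendsto (fun h : ℝ => h⁻¹ • (f (x + h • EuclideanSpace.single n (1 : ℝ)) - f x))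
    (𝓝[≠] 0) (𝓝 (g x))

/-- `f` is `k`-times continuously partially differentiable on the open set `Ω`: it is continuous
on `Ω` if `k = 0`, and for `k + 1` all first partial derivatives of `f` exist on `Ω`, are
continuous on `Ω` and are `k`-times continuously partially differentiable on `Ω`. -/
def IsCkOn {d : ℕ} {E : Type*} [AddCommGroup E] [Module ℝ E] [TopologicalSpace E] :
    ℕ → (EuclideanSpace ℝ (Fin d) → E) → Set (EuclideanSpace ℝ (Fin d)) → Prop
  | 0, f, Ω => ContinuousOn f Ω
  | k + 1, f, Ω => ∀ n : Fin d, ∃ g : EuclideanSpace ℝ (Fin d) → E,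
      HasPartialDerivOn n f g Ω ∧ ContinuousOn g Ω ∧ IsCkOn k g Ω

/-! A family that is pointwise bounded on `G` is bounded, hence relatively compact. Since `G`
separates points, convergence against every functional in `G` leaves only one cluster point, so the
family converges (`DeterminesBoundedness.exists_tendsto`). Applied to values of `f` near a point
this gives continuity; applied to difference quotients it gives partial derivatives, and induction
on `k` does the rest. -/

section BoundednessDetermining

variable {𝕜 E : Type*} [RCLike 𝕜] [AddCommGroup E] [Module 𝕜 E] [TopologicalSpace E]

/-- A subspace that determines boundedness separates the points of a Hausdorff space. -/
theorem DeterminesBoundedness.eq_of_forall_eq [ContinuousSMul 𝕜 E] [T2Space E]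
    {G : Submodule 𝕜 (E →L[𝕜] 𝕜)} (hG : DeterminesBoundedness G) {x y : E}
    (h : ∀ e' ∈ G, e' x = e' y) : x = y := by
  by_contra hxy
  -- `G` vanishes on the line through `x - y`, so the whole line is bounded, impossible in a
  -- Hausdorff space unless `x = y`.
  have hb : IsVonNBounded 𝕜 (Set.range fun t : 𝕜 => t • (x - y)) := by
    refine hG _ ((isVonNBounded_sigmaTopology_iff G _).2 fun e' he => ⟨0, ?_⟩)
    rintro _ ⟨t, rfl⟩
    simp [h e' he]
  have hV : {x - y}ᶜ ∈ 𝓝 (0 : E) :=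
    isOpen_compl_singleton.mem_nhds fun h0 => hxy (sub_eq_zero.1 h0.symm)
  obtain ⟨a, ha, ha0⟩ := ((hb hV).and (eventually_ne_cobounded (0 : 𝕜))).exists
  obtain ⟨u, hu, hux⟩ := ha ⟨a, rfl⟩
  exact hu (smul_right_injective E ha0 hux)

/-- In a semi-Montel space, an eventually bounded family whose images under all functionals of a
boundedness-determining subspace converge is itself convergent. -/
theorem DeterminesBoundedness.exists_tendsto [IsTopologicalAddGroup E] [ContinuousSMul 𝕜 E]
    [T2Space E] [MontelSpace 𝕜 E] {G : Submodule 𝕜 (E →L[𝕜] 𝕜)} (hG : DeterminesBoundedness G)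
    {ι : Type*} {l : Filter ι} [l.NeBot] {u : ι → E} {S : Set ι} (hS : S ∈ l)
    (hb : ∀ e' ∈ G, ∃ C : ℝ, ∀ i ∈ S, ‖e' (u i)‖ ≤ C)
    {c : (E →L[𝕜] 𝕜) → 𝕜} (hc : ∀ e' ∈ G, Tendsto (fun i => e' (u i)) l (𝓝 (c e'))) :
    ∃ y, Tendsto u l (𝓝 y) ∧ ∀ e' ∈ G, e' y = c e' := by
  have hB : IsVonNBounded 𝕜 (u '' S) :=
    hG _ ((isVonNBounded_sigmaTopology_iff G _).2 fun e' he => by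
      obtain ⟨C, hC⟩ := hb e' he
      exact ⟨C, by rintro _ ⟨i, hi, rfl⟩; exact hC i hi⟩)
  have hK : IsCompact (closure (u '' S)) :=
    MontelSpace.isCompact_of_isClosed_of_isVonNBounded 𝕜 isClosed_closure hB.closure
  have hmem : closure (u '' S) ∈ map u l :=
    mem_of_superset (image_mem_map hS) subset_closure
  have hval : ∀ z, ClusterPt z (map u l) → ∀ e' ∈ G, e' z = c e' := by
    intro z hz e' he
    have h1 : MapClusterPt (e' z) (map u l) e' :=
      hz.map e'.continuous.continuousAt tendsto_map
    have h2 : ClusterPt (e' z) (𝓝 (c e')) := ClusterPt.mono h1 (hc e' he)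
    exact eq_of_nhds_neBot h2
  obtain ⟨y, -, hy⟩ := hK.exists_clusterPt (le_principal_iff.2 hmem)
  refine ⟨y, hK.le_nhds_of_unique_clusterPt hmem fun z _ hz => ?_, hval y hy⟩
  exact hG.eq_of_forall_eq fun e' he => (hval z hz e' he).trans (hval y hy e' he).symm

/-- In a semi-Montel space, continuity on an open subset of a locally compact space can be tested
on a boundedness-determining subspace. -/
theorem DeterminesBoundedness.continuousOn [IsTopologicalAddGroup E] [ContinuousSMul 𝕜 E]
    [T2Space E] [MontelSpace 𝕜 E] {G : Submodule 𝕜 (E →L[𝕜] 𝕜)} (hG : DeterminesBoundedness G)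
    {X : Type*} [TopologicalSpace X] [LocallyCompactSpace X] {Ω : Set X} (hΩ : IsOpen Ω)
    {f : X → E} (hf : ∀ e' ∈ G, ContinuousOn (fun x => e' (f x)) Ω) : ContinuousOn f Ω := by
  intro x hx
  obtain ⟨K, hK, hKΩ, hKc⟩ := local_compact_nhds (hΩ.mem_nhds hx)
  obtain ⟨y, hy, hyc⟩ := hG.exists_tendsto (u := f) (c := fun e' => e' (f x)) hK
    (fun e' he => hKc.exists_bound_of_continuousOn ((hf e' he).mono hKΩ))
    (fun e' he => (hf e' he).continuousAt (hΩ.mem_nhds hx))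
  rw [hG.eq_of_forall_eq hyc] at hy
  exact hy.mono_left nhdsWithin_le_nhds

end BoundednessDetermining

section PartialDerivatives

variable {d : ℕ} {F : Type*} [AddCommGroup F] [Module ℝ F] [TopologicalSpace F]

theorem tendsto_add_smul_nhds {V : Type*} [AddCommGroup V] [Module ℝ V] [TopologicalSpace V]
    [ContinuousAdd V] [ContinuousSMul ℝ V] (x v : V) :
    Tendsto (fun h : ℝ => x + h • v) (𝓝 0) (𝓝 x) := by
  have : Continuous fun h : ℝ => x + h • v := by fun_prop
  simpa using this.tendsto 0

theorem HasPartialDerivOn.congr {n : Fin d} {f f' g g' : EuclideanSpace ℝ (Fin d) → F}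
    {Ω : Set (EuclideanSpace ℝ (Fin d))} (hΩ : IsOpen Ω) (h : HasPartialDerivOn n f g Ω)
    (hf : Set.EqOn f f' Ω) (hg : Set.EqOn g g' Ω) : HasPartialDerivOn n f' g' Ω := by
  intro x hx
  rw [← hg hx]
  refine (h x hx).congr' ?_
  have := (tendsto_add_smul_nhds x (EuclideanSpace.single n (1 : ℝ))).eventually
    (hΩ.mem_nhds hx)
  filter_upwards [this.filter_mono nhdsWithin_le_nhds] with t ht
  rw [hf ht, hf hx]

theorem IsCkOn.congr {k : ℕ} {f f' : EuclideanSpace ℝ (Fin d) → F}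
    {Ω : Set (EuclideanSpace ℝ (Fin d))} (hΩ : IsOpen Ω) (h : IsCkOn k f Ω)
    (hf : Set.EqOn f f' Ω) : IsCkOn k f' Ω := by
  cases k with
  | zero => exact ContinuousOn.congr h hf.symm
  | succ k =>
    intro n
    obtain ⟨g, hg, hgc, hgk⟩ := h n
    exact ⟨g, hg.congr hΩ hf fun _ _ => rfl, hgc, hgk⟩

/-- Difference quotients along a line on which the function has partial derivatives are bounded
on a neighbourhood of `0` that depends only on the base point and the domain. -/
theorem HasPartialDerivOn.exists_bound_quotient {F : Type*} [NormedAddCommGroup F]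
    [NormedSpace ℝ F] {n : Fin d} {f g : EuclideanSpace ℝ (Fin d) → F}
    {Ω : Set (EuclideanSpace ℝ (Fin d))} (hfg : HasPartialDerivOn n f g Ω)
    {x : EuclideanSpace ℝ (Fin d)} {K : Set ℝ} (hK : IsCompact K) (h0 : (0 : ℝ) ∈ K)
    (hKΩ : ∀ t ∈ K, x + t • EuclideanSpace.single n (1 : ℝ) ∈ Ω) :
    ∃ C : ℝ, ∀ t ∈ K \ {0},
      ‖t⁻¹ • (f (x + t • EuclideanSpace.single n (1 : ℝ)) - f x)‖ ≤ C := by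
  set v : EuclideanSpace ℝ (Fin d) := EuclideanSpace.single n (1 : ℝ)
  have hd : ∀ t ∈ K, HasDerivAt (fun s : ℝ => f (x + s • v)) (g (x + t • v)) t := by
    intro t ht
    rw [hasDerivAt_iff_tendsto_slope_zero]
    simpa only [add_smul, add_assoc] using hfg _ (hKΩ t ht)
  -- Filling in the derivative at `0` makes the quotient continuous on all of the compact set `K`,
  -- hence bounded.
  have hc : ContinuousOn (dslope (fun s : ℝ => f (x + s • v)) 0) K := by
    intro t ht
    rcases eq_or_ne t 0 with rfl | ht0
    · exact (continuousAt_dslope_same.2 (hd 0 h0).differentiableAt).continuousWithinAt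
    · exact ((continuousAt_dslope_of_ne ht0).2 (hd t ht).continuousAt).continuousWithinAt
  obtain ⟨C, hC⟩ := hK.exists_bound_of_continuousOn hc
  refine ⟨C, fun t ht => ?_⟩
  simpa [dslope_of_ne _ ht.2, slope_def_module] using hC t ht.1

end PartialDerivatives

/-- `e'` is only `𝕜`-linear, so the real scalar is first moved into `𝕜`. -/
theorem map_inv_real_smul_sub {𝕜 E : Type*} [RCLike 𝕜] [AddCommGroup E] [Module 𝕜 E] [Module ℝ E]
    [IsScalarTower ℝ 𝕜 E] [TopologicalSpace E] (e' : E →L[𝕜] 𝕜) (t : ℝ) (x y : E) :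
    e' (t⁻¹ • (x - y)) = t⁻¹ • (e' x - e' y) := by
  rw [← map_sub, ← smul_one_smul 𝕜 t⁻¹ (x - y), map_smul, smul_one_smul]

theorem mainTheorem6 {𝕜 : Type*} [RCLike 𝕜]
    {E : Type*} [AddCommGroup E] [Module 𝕜 E] [Module ℝ E] [IsScalarTower ℝ 𝕜 E]
    [TopologicalSpace E] [IsTopologicalAddGroup E] [ContinuousSMul 𝕜 E]
    [LocallyConvexSpace ℝ E] [T2Space E] [MontelSpace 𝕜 E]
    (G : Submodule 𝕜 (E →L[𝕜] 𝕜)) (hG : DeterminesBoundedness G)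
    (d k : ℕ) (Ω : Set (EuclideanSpace ℝ (Fin d))) (hΩ : IsOpen Ω)
    (f : EuclideanSpace ℝ (Fin d) → E)
    (hf : ∀ e' ∈ G, IsCkOn k (fun x => e' (f x)) Ω) :
    IsCkOn k f Ω := by
  induction k generalizing f with
  | zero => exact hG.continuousOn hΩ hf
  | succ k ih =>
    intro n
    choose! p hp hpc hpk using fun e' he => hf e' he n
    have hlim : ∀ x ∈ Ω, ∃ y : E,
        Tendsto (fun h : ℝ => h⁻¹ • (f (x + h • EuclideanSpace.single n (1 : ℝ)) - f x))
          (𝓝[≠] 0) (𝓝 y) ∧ ∀ e' ∈ G, e' y = p e' x := by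
      intro x hx
      -- `K` is fixed before `e'`: one set of increments must give bounds for every functional in
      -- `G`.
      obtain ⟨K, hK, hKΩ, hKc⟩ := local_compact_nhds
        ((tendsto_add_smul_nhds x (EuclideanSpace.single n (1 : ℝ))).eventually (hΩ.mem_nhds hx))
      refine hG.exists_tendsto (S := K \ {0}) (sdiff_mem_nhdsWithin_compl hK {0})
        (fun e' he => ?_) (fun e' he => ?_)
      · simp only [map_inv_real_smul_sub]
        exact (hp e' he).exists_bound_quotient hKc (mem_of_mem_nhds hK) hKΩ
      · simp only [map_inv_real_smul_sub]
        exact hp e' he x hx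
    choose! g hg hgp using hlim
    -- The two sides may differ off `Ω`, so regularity is transferred by congruence on `Ω`.
    have hpg : ∀ e' ∈ G, Set.EqOn (p e') (fun x => e' (g x)) Ω :=
      fun e' he x hx => (hgp x hx e' he).symm
    exact ⟨g, hg, hG.continuousOn hΩ fun e' he => (hpc e' he).congr (hpg e' he).symm,
      ih g fun e' he => (hpk e' he).congr hΩ (hpg e' he)⟩
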